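/- Let $U\subset\mathbb{C}^k$ be open and connected, and either bounded or Kobayashi hyperbolic. Assume that every $q\in\partial U$ has a continuous p.s.h. barrier: there are an open neighbourhood $N_q$ of $q$ and a continuous plurisubharmonic function $\rho_q$ on $N_q$ with $\rho_q<0$ on $U\cap N_q$ and $\lim_{p\to q}\rho_q(p)=0$. Let $f:U\to\mathbb{C}^k$ be holomorphic and open, let $\mathcal{C}\subset U$ satisfy $f(\mathcal{C})\subset\mathcal{C}$, and let $V$ be the interior of the closure of $\mathcal{C}$ in $U$. Then all iterates $f^n$ are defined on $V$ with values in $U$. The family $\{f^n\}_{n\in\mathbb{N}}$ is equicontinuous on $V$ with respect to the Kobayashi distance of $U$; if $U$ is bounded, it is a normal family on $V$, i.e. every sequence of iterates has a subsequence converging locally uniformly on $V$ to a map into $\mathbb{C}^k$. Let $W$ be a connected component of $V$ that contains a recurrent point $p_0$, i.e. $f^{n_i}(p_0)\to p_0$ for some $n_1<n_2<\cdots$. Then at least one of the following holds: 1) $W$ is the (immediate) basin of attraction of an attracting periodic orbit: there is $p\in W$ with $f^m(p)=p$ for some $m\ge1$, all eigenvalues of $D(f^m)(p)$ having modulus $<1$,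 such that $W$ is the connected component containing $p$ of the set of points of $V$ whose forward orbit under $f$ stays in $V$ and converges to the orbit of $p$; 2) $W$ is a Siegel domain: there are $n_1<n_2<\cdots$ with $f^{n_i}\to\mathrm{Id}$ locally uniformly on $W$; 3) every map $h:W\to\mathbb{C}^k$ that is the locally uniform limit on $W$ of a subsequence of $\{f^n\}$ satisfies $0<\mathrm{rank}\,h<k$, where $\mathrm{rank}\,h$ is the maximum over $x\in W$ of the rank of the complex derivative of $h$ at $x$. -/

import Mathlib

open Set Filter Topology
open scoped ENNReal

/-- The space `ℂᵏ`. -/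
abbrev Ck (k : ℕ) : Type := EuclideanSpace ℂ (Fin k)

/-- `ρ` is a continuous plurisubharmonic function on the open set `N`: it is continuous on `N` and,
whenever the closed disc `{x + ζ v : |ζ| ≤ 1}` lies in `N`, its value at the centre is at most its
mean over the boundary circle. (By continuity the mean is that of an integrable function.) -/
def ContinuousPSHOn {k : ℕ} (ρ : Ck k → ℝ) (N : Set (Ck k)) : Prop :=
  ContinuousOn ρ N ∧
    ∀ x v : Ck k, (∀ ζ : ℂ, ‖ζ‖ ≤ 1 → x + ζ • v ∈ N) →
      ρ x ≤ Real.circleAverage (fun ζ : ℂ => ρ (x + ζ • v)) 0 1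

/-- `U` has a continuous p.s.h. barrier at the boundary point `q`: a continuous p.s.h. function `ρ`
on an open neighbourhood `N` of `q`, negative on `U ∩ N`, with `ρ p → 0` as `p → q`. -/
def HasPSHBarrierAt {k : ℕ} (U : Set (Ck k)) (q : Ck k) : Prop :=
  ∃ (N : Set (Ck k)) (ρ : Ck k → ℝ), IsOpen N ∧ q ∈ N ∧ ContinuousPSHOn ρ N ∧
    (∀ p ∈ U ∩ N, ρ p < 0) ∧ Tendsto ρ (𝓝 q) (𝓝 0)

/-- The Poincaré distance of the unit disc. -/
noncomputable def poincareDist (a b : ℂ) : ℝ :=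
  Real.artanh ‖(a - b) / (1 - (starRingEnd ℂ) a * b)‖

/-- `KobayashiChain U x y ℓ`: the points `x` and `y` of `U` are joined by a finite chain of
holomorphic discs in `U` of total Poincaré length `ℓ`. -/
inductive KobayashiChain {k : ℕ} (U : Set (Ck k)) : Ck k → Ck k → ℝ → Prop
  | nil (x : Ck k) (hx : x ∈ U) : KobayashiChain U x x 0
  | cons (φ : ℂ → Ck k) (hφ : DifferentiableOn ℂ φ (Metric.ball 0 1))
      (hφU : MapsTo φ (Metric.ball 0 1) U)
      (a b : ℂ) (ha : a ∈ Metric.ball (0 : ℂ) 1) (hb : b ∈ Metric.ball (0 : ℂ) 1)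
      (z : Ck k) (ℓ : ℝ) (h : KobayashiChain U (φ b) z ℓ) :
      KobayashiChain U (φ a) z (poincareDist a b + ℓ)

/-- The Kobayashi pseudodistance of `U` (equal to `∞` where no chain exists). -/
noncomputable def kobayashiDist {k : ℕ} (U : Set (Ck k)) (x y : Ck k) : ℝ≥0∞ :=
  ⨅ (ℓ : ℝ) (_ : KobayashiChain U x y ℓ), ENNReal.ofReal ℓ

/-- `U` is Kobayashi hyperbolic: its Kobayashi pseudodistance separates points. -/
def IsKobayashiHyperbolic {k : ℕ} (U : Set (Ck k)) : Prop :=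
  ∀ x ∈ U, ∀ y ∈ U, x ≠ y → 0 < kobayashiDist U x y

/-- The interior of the closure of `C` relative to `U`. -/
def interiorOfClosureIn {k : ℕ} (U C : Set (Ck k)) : Set (Ck k) :=
  interior (closure C ∩ U)

/-- Normality of the iterates of `f` on `V`: every sequence of iterates has a subsequence that
converges uniformly on a neighbourhood of each point of `V`. -/
def IteratesNormalOn {k : ℕ} (f : Ck k → Ck k) (V : Set (Ck k)) : Prop :=
  ∀ n : ℕ → ℕ, ∃ ψ : ℕ → ℕ, StrictMono ψ ∧ ∃ h : Ck k → Ck k,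
    TendstoLocallyUniformlyOn (fun i => f^[n (ψ i)]) h atTop V

/-- Equicontinuity on `V` of the iterates of `f` for the Kobayashi distance of `U`. -/
def IteratesKobayashiEquicontinuousOn {k : ℕ} (f : Ck k → Ck k) (U V : Set (Ck k)) : Prop :=
  ∀ x ∈ V, ∀ ε : ℝ≥0∞, 0 < ε →
    ∀ᶠ y in 𝓝 x, ∀ n : ℕ, kobayashiDist U (f^[n] x) (f^[n] y) < ε

/-- `p` is recurrent: some subsequence of its orbit converges to `p`. -/
def IsRecurrentPoint {k : ℕ} (f : Ck k → Ck k) (p : Ck k) : Prop :=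
  ∃ n : ℕ → ℕ, StrictMono n ∧ Tendsto (fun i => f^[n i] p) atTop (𝓝 p)

/-- `p` is an attracting periodic point of `f`: for some `m ≥ 1`, `p` is fixed by `f^m` and all
eigenvalues of the derivative of `f^m` at `p` have modulus `< 1`. -/
def IsAttractingPeriodicPoint {k : ℕ} (f : Ck k → Ck k) (p : Ck k) : Prop :=
  ∃ m : ℕ, 0 < m ∧ f^[m] p = p ∧ DifferentiableAt ℂ f^[m] p ∧
    spectralRadius ℂ (fderiv ℂ f^[m] p) < 1

/-- The basin in `V` of the orbit of `p`: the points whose whole forward orbit stays in `V` and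
whose distance to the orbit of `p` tends to `0`. -/
def basinIn {k : ℕ} (f : Ck k → Ck k) (V : Set (Ck k)) (p : Ck k) : Set (Ck k) :=
  {x | (∀ n : ℕ, f^[n] x ∈ V) ∧
    Tendsto (fun n : ℕ => Metric.infDist (f^[n] x) (range fun j : ℕ => f^[j] p)) atTop (𝓝 0)}

/-- `W` is the basin of attraction, for `f : V → V`, of an attracting periodic orbit that meets
`W`: the component of the basin in `V` around a point of that orbit. -/
def IsAttractingBasin {k : ℕ} (f : Ck k → Ck k) (V W : Set (Ck k)) : Prop :=
  ∃ p ∈ W, IsAttractingPeriodicPoint f p ∧ W = connectedComponentIn (basinIn f V p) p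

/-- `W` is a Siegel domain: a subsequence of the iterates converges to the identity on `W`. -/
def IsSiegelDomain {k : ℕ} (f : Ck k → Ck k) (W : Set (Ck k)) : Prop :=
  ∃ n : ℕ → ℕ, StrictMono n ∧ TendstoLocallyUniformlyOn (fun i => f^[n i]) id atTop W

/-- The rank on `W` of a holomorphic map `h`: the maximal rank of its derivative at points
of `W`. -/
noncomputable def rankOn {k : ℕ} (h : Ck k → Ck k) (W : Set (Ck k)) : ℕ :=
  sSup {r : ℕ | ∃ x ∈ W, r = Module.finrank ℂ (LinearMap.range (fderiv ℂ h x).toLinearMap)}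

/-! The barriers force every interior point of the closure of `U` into `U`. Since `f` is open, `f ''
V` is then an open subset of the closure of `C` and lies in `V`. So `f` is a self-map of the
hyperbolic set `V`, and its iterates do not increase the Kobayashi distance. This gives
equicontinuity, and Montel's theorem gives normality for bounded `U`. By Barth's theorem
(`IsKobayashiHyperbolic.exists_dist_lt`) Kobayashi estimates yield Euclidean ones.

Suppose a limit `h` of iterates on `W` has rank `0` or `k`. In rank `0` it is a constant `q`, and `q
∈ V` because a recurrent orbit stays in a compact subset of `V`
(`IsRecurrentPoint.exists_isCompact`). An iterate `p` of `q` lies in `W` and is periodic.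
Derivatives of iterates at `p` tend to `0`, so `p` attracts, and nonexpansion carries all of `W` to
its orbit (`isAttractingBasin_of_const_limit`).

In rank `k`, `h` is open at some `x`. Consecutive quotients `f^[n (i+1) - n i]`, along a sparse
subsequence, tend to the identity near `h x`. A further iterate transports this to an open subset of
`W`, and Vitali's theorem spreads it over `W` (`isSiegelDomain_of_open_limit`). -/

/-! ### Barriers -/

/-- A domain with a continuous p.s.h. barrier at each boundary point is the interior of its
closure. -/
theorem interior_closure_subset_of_barrier {k : ℕ} {U : Set (Ck k)}
    (hbar : ∀ q ∈ frontier U, HasPSHBarrierAt U q) : interior (closure U) ⊆ U := by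
  intro q hq
  by_contra hqU
  have hqf : q ∈ frontier U :=
    ⟨interior_subset hq, fun h => hqU (interior_subset h)⟩
  obtain ⟨N, ρ, hNo, hqN, ⟨hρc, hρm⟩, hneg, hlim⟩ := hbar q hqf
  have hρq : ρ q = 0 :=
    tendsto_nhds_unique (hρc.continuousAt (hNo.mem_nhds hqN)) hlim
  obtain ⟨r, hr, hball⟩ := Metric.mem_nhds_iff.1
    (inter_mem (hNo.mem_nhds hqN) (isOpen_interior.mem_nhds hq))
  -- `U` is dense near `q`, so continuity makes `q` a local maximum of `ρ`, with value `0`.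
  have hnonpos : ∀ p ∈ Metric.ball q r, ρ p ≤ 0 := by
    intro p hp
    have hpN := (hball hp).1
    have hpU : p ∈ closure U := interior_subset (hball hp).2
    have hne : (𝓝[U] p).NeBot := mem_closure_iff_nhdsWithin_neBot.1 hpU
    have ht : Tendsto ρ (𝓝[U] p) (𝓝 (ρ p)) :=
      (hρc.continuousAt (hNo.mem_nhds hpN)).mono_left nhdsWithin_le_nhds
    refine le_of_tendsto ht ?_
    filter_upwards [self_mem_nhdsWithin, nhdsWithin_le_nhds (hNo.mem_nhds hpN)] with z hz hzN
    exact (hneg z ⟨hz, hzN⟩).le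
  -- On the circle centred at `q` through a point `p` of `U`, `ρ ≤ 0` and `ρ p < 0`; the mean is
  -- negative, against `ρ q = 0`.
  obtain ⟨p, hpU, hpq⟩ := Metric.mem_closure_iff.1 (interior_subset hq) r hr
  rw [dist_comm] at hpq
  have hdisc : ∀ ζ : ℂ, ‖ζ‖ ≤ 1 → q + ζ • (p - q) ∈ Metric.ball q r := by
    intro ζ hζ
    rw [Metric.mem_ball, dist_eq_norm, add_sub_cancel_left, norm_smul]
    calc ‖ζ‖ * ‖p - q‖ ≤ 1 * ‖p - q‖ := by gcongr
      _ < r := by rwa [one_mul, ← dist_eq_norm]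
  have hmean := hρm q (p - q) fun ζ hζ => (hball (hdisc ζ hζ)).1
  rw [hρq, Real.circleAverage_def, smul_eq_mul] at hmean
  have hcirc : ∀ θ : ℝ, ‖circleMap 0 1 θ‖ ≤ 1 := fun θ => by simp
  have hcont : Continuous fun θ : ℝ => -ρ (q + circleMap 0 1 θ • (p - q)) := by
    refine (hρc.comp_continuous (by fun_prop) fun θ => ?_).neg
    exact (hball (hdisc _ (hcirc θ))).1
  have hpos := intervalIntegral.integral_pos Real.two_pi_pos hcont.continuousOn
    (fun θ _ => neg_nonneg.2 (hnonpos _ (hdisc _ (hcirc θ))))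
    ⟨0, ⟨le_rfl, Real.two_pi_pos.le⟩, by
      have := hneg p ⟨hpU, (hball hpq).1⟩
      simpa [circleMap] using this⟩
  rw [intervalIntegral.integral_neg] at hpos
  have : 0 < (2 * Real.pi)⁻¹ := inv_pos.2 Real.two_pi_pos
  nlinarith

/-! ### Holomorphic maps between normed spaces -/

section Holomorphic

variable {E F : Type*} [NormedAddCommGroup E] [NormedSpace ℂ E]
  [NormedAddCommGroup F] [NormedSpace ℂ F]

/-- Schwarz lemma: the bound `M` puts the image in the closed ball of radius `2 * M` about `f c`. -/
theorem dist_le_of_norm_le_on_ball {f : E → F} {c y : E} {R M : ℝ}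
    (hf : DifferentiableOn ℂ f (Metric.ball c R)) (hM : ∀ z ∈ Metric.ball c R, ‖f z‖ ≤ M)
    (hy : y ∈ Metric.ball c R) : dist (f y) (f c) ≤ 2 * M / R * dist y c := by
  have hR : 0 < R := Metric.nonempty_ball.1 ⟨y, hy⟩
  refine Complex.dist_le_div_mul_dist_of_mapsTo_ball hf (fun z hz => ?_) hy
  rw [Metric.mem_closedBall, dist_eq_norm]
  linarith [norm_sub_le (f z) (f c), hM z hz, hM c (Metric.mem_ball_self hR)]

theorem norm_fderiv_le_of_norm_le_on_ball {f : E → F} {c : E} {R M : ℝ} (hR : 0 < R)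
    (hf : DifferentiableOn ℂ f (Metric.ball c R)) (hM : ∀ z ∈ Metric.ball c R, ‖f z‖ ≤ M) :
    ‖fderiv ℂ f c‖ ≤ 2 * M / R := by
  refine Complex.norm_fderiv_le_div_of_mapsTo_ball hf (fun z hz => ?_) hR
  rw [Metric.mem_closedBall, dist_eq_norm]
  linarith [norm_sub_le (f z) (f c), hM z hz, hM c (Metric.mem_ball_self hR)]

/-- Pointwise convergence together with (eventual) equicontinuity gives locally uniform
convergence. -/
theorem tendstoLocallyUniformlyOn_of_tendsto_of_equicontinuous {X Y : Type*} [TopologicalSpace X]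
    [PseudoMetricSpace Y] {Ω : Set X} (hΩ : IsOpen Ω) {G : ℕ → X → Y} {g : X → Y}
    (heq : ∀ x ∈ Ω, ∀ ε > 0, ∃ t ∈ 𝓝 x, ∀ᶠ i in atTop, ∀ y ∈ t, dist (G i y) (G i x) < ε)
    (hlim : ∀ x ∈ Ω, Tendsto (fun i => G i x) atTop (𝓝 (g x))) :
    TendstoLocallyUniformlyOn G g atTop Ω := by
  rw [Metric.tendstoLocallyUniformlyOn_iff]
  intro ε hε x hx
  obtain ⟨t, ht, hG⟩ := heq x hx (ε / 4) (by positivity)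
  refine ⟨t ∩ Ω, nhdsWithin_le_nhds (inter_mem ht (hΩ.mem_nhds hx)), ?_⟩
  have hx' := Metric.tendsto_nhds.1 (hlim x hx) (ε / 4) (by positivity)
  filter_upwards [hG, hx'] with i hi hxi y hy
  have hgy : dist (g y) (g x) ≤ ε / 4 := by
    refine le_of_tendsto ((hlim y hy.2).dist (hlim x hx)) ?_
    filter_upwards [hG] with j hj using (hj y hy.1).le
  have h1 := hi y hy.1
  calc dist (g y) (G i y) ≤ dist (g y) (g x) + dist (g x) (G i x) + dist (G i x) (G i y) :=
        dist_triangle4 _ _ _ _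
    _ < ε := by linarith [dist_comm (g x) (G i x), dist_comm (G i x) (G i y)]

/-- The bound is asked only eventually, since iterates tending to the identity are controlled only
from some index on. -/
theorem eventually_dist_lt_of_norm_le_on_ball {Ω : Set E} {G : ℕ → E → F} {x : E} {R M : ℝ}
    (hR : 0 < R) (hsub : Metric.ball x R ⊆ Ω) (hG : ∀ i, DifferentiableOn ℂ (G i) Ω)
    (hM : ∀ᶠ i in atTop, ∀ y ∈ Metric.ball x R, ‖G i y‖ ≤ M) {ε : ℝ} (hε : 0 < ε) :
    ∃ t ∈ 𝓝 x, ∀ᶠ i in atTop, ∀ y ∈ t, dist (G i y) (G i x) < ε := by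
  have hcont : ContinuousAt (fun y => 2 * M / R * dist y x) x := by fun_prop
  have hlt : ∀ᶠ y in 𝓝 x, 2 * M / R * dist y x < ε :=
    hcont.eventually_lt continuousAt_const (by simpa using hε)
  refine ⟨_, inter_mem hlt (Metric.ball_mem_nhds x hR), ?_⟩
  filter_upwards [hM] with i hi y hy
  exact (dist_le_of_norm_le_on_ball ((hG i).mono hsub) hi hy.2).trans_lt hy.1

/-- **Montel's theorem** in several variables. -/
theorem exists_subseq_tendstoLocallyUniformlyOn [SecondCountableTopology E] [ProperSpace F]
    {Ω : Set E} (hΩ : IsOpen Ω) {G : ℕ → E → F} (hG : ∀ i, DifferentiableOn ℂ (G i) Ω)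
    (hbdd : ∀ x ∈ Ω, ∃ R > 0, Metric.ball x R ⊆ Ω ∧
      ∃ M : ℝ, ∀ i, ∀ y ∈ Metric.ball x R, ‖G i y‖ ≤ M) :
    ∃ ψ : ℕ → ℕ, StrictMono ψ ∧ ∃ g : E → F,
      TendstoLocallyUniformlyOn (fun i => G (ψ i)) g atTop Ω := by
  obtain ⟨D, hDc, hDd⟩ := TopologicalSpace.exists_countable_dense Ω
  have hbd : ∀ x : D, ∃ M : ℝ, ∀ i, G i x ∈ Metric.closedBall (0 : F) M := by
    intro x
    obtain ⟨R, hR, -, M, hM⟩ := hbdd x.1 x.1.2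
    exact ⟨M, fun i => by simpa using hM i _ (Metric.mem_ball_self hR)⟩
  choose M hM using hbd
  have : Countable D := hDc
  -- Compactness of a countable product replaces the diagonal extraction.
  have hK : IsCompact (Set.pi univ fun x : D => Metric.closedBall (0 : F) (M x)) :=
    isCompact_univ_pi fun x => isCompact_closedBall _ _
  obtain ⟨a, -, ψ, hψ, hlim⟩ := hK.tendsto_subseq (x := fun i (x : D) => G i x)
    fun i x _ => hM x i
  have heq : ∀ x ∈ Ω, ∀ ε > 0, ∃ t ∈ 𝓝 x, ∀ᶠ i in atTop,
      ∀ y ∈ t, dist (G (ψ i) y) (G (ψ i) x) < ε := by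
    intro x hx ε hε
    obtain ⟨R, hR, hsub, M, hM⟩ := hbdd x hx
    exact eventually_dist_lt_of_norm_le_on_ball (G := fun i => G (ψ i)) hR hsub
      (fun i => hG _) (Eventually.of_forall fun i => hM _) hε
  have hconv : ∀ x ∈ Ω, ∃ l, Tendsto (fun i => G (ψ i) x) atTop (𝓝 l) := by
    intro x hx
    refine cauchySeq_tendsto_of_complete (Metric.cauchySeq_iff.2 fun ε hε => ?_)
    obtain ⟨t, ht, hev⟩ := heq x hx (ε / 3) (by positivity)
    have ht' : ((↑) : Ω → E) ⁻¹' t ∈ 𝓝 (⟨x, hx⟩ : Ω) := continuous_subtype_val.continuousAt ht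
    obtain ⟨d, hdt, hd⟩ := mem_closure_iff_nhds.1 (hDd ⟨x, hx⟩) _ ht'
    have hcs : CauchySeq fun i => G (ψ i) d :=
      ((tendsto_pi_nhds.1 hlim) ⟨d, hd⟩).cauchySeq
    obtain ⟨N, hN⟩ := Metric.cauchySeq_iff.1 hcs (ε / 3) (by positivity)
    obtain ⟨N', hN'⟩ := eventually_atTop.1 hev
    refine ⟨max N N', fun m hm n hn => ?_⟩
    have h1 := hN m (le_of_max_le_left hm) n (le_of_max_le_left hn)
    have h2 := hN' m (le_of_max_le_right hm) d hdt
    have h3 := hN' n (le_of_max_le_right hn) d hdt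
    have h4 := dist_triangle4 (G (ψ m) x) (G (ψ m) d) (G (ψ n) d) (G (ψ n) x)
    rw [dist_comm] at h2
    linarith
  choose! g hg using hconv
  exact ⟨ψ, hψ, g, tendstoLocallyUniformlyOn_of_tendsto_of_equicontinuous hΩ heq hg⟩

/-- The derivatives of a locally uniformly convergent sequence of holomorphic maps converge, and
the limit is holomorphic. -/
theorem differentiableAt_and_tendsto_fderiv_of_tendstoLocallyUniformlyOn [ProperSpace E]
    [CompleteSpace F] {Ω : Set E} (hΩ : IsOpen Ω) {G : ℕ → E → F} {g : E → F}
    (hG : ∀ i, DifferentiableOn ℂ (G i) Ω)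
    (hlim : TendstoLocallyUniformlyOn G g atTop Ω) {x : E} (hx : x ∈ Ω) :
    DifferentiableAt ℂ g x ∧
      Tendsto (fun i => fderiv ℂ (G i) x) atTop (𝓝 (fderiv ℂ g x)) := by
  obtain ⟨R, hR, hsub⟩ := Metric.nhds_basis_closedBall.mem_iff.1 (hΩ.mem_nhds hx)
  have hunif := (tendstoLocallyUniformlyOn_iff_forall_isCompact hΩ).1 hlim _ hsub
    (isCompact_closedBall x R)
  have hR2 : 0 < R / 2 := by positivity
  have hballs : ∀ y ∈ Metric.ball x (R / 2), Metric.ball y (R / 2) ⊆ Metric.closedBall x R :=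
    fun y hy => (Metric.ball_subset_ball' (by
      have := Metric.mem_ball.1 hy
      linarith)).trans Metric.ball_subset_closedBall
  have hdiff : ∀ i, ∀ y ∈ Metric.closedBall x R, DifferentiableAt ℂ (G i) y := fun i y hy =>
    (hG i).differentiableAt (hΩ.mem_nhds (hsub hy))
  -- Cauchy estimate on balls of radius `R / 2`: differences at most `ε * R / 8` have derivatives at
  -- most `ε / 2`.
  have hcauchy : UniformCauchySeqOn (fun i => fderiv ℂ (G i)) atTop (Metric.ball x (R / 2)) := by
    rw [Metric.uniformCauchySeqOn_iff]
    intro ε hε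
    obtain ⟨N, hN⟩ := Metric.uniformCauchySeqOn_iff.1 hunif.uniformCauchySeqOn (ε * R / 8)
      (by positivity)
    refine ⟨N, fun m hm n hn y hy => ?_⟩
    have hyR : y ∈ Metric.closedBall x R := hballs y hy (Metric.mem_ball_self hR2)
    have hb := norm_fderiv_le_of_norm_le_on_ball (f := G m - G n) (M := ε * R / 8) hR2
      (fun z hz => ((hdiff m z (hballs y hy hz)).sub
        (hdiff n z (hballs y hy hz))).differentiableWithinAt)
      (fun z hz => by
        have := hN m hm n hn z (hballs y hy hz)
        rw [dist_eq_norm] at this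
        exact this.le)
    rw [fderiv_sub (hdiff m y hyR) (hdiff n y hyR)] at hb
    rw [dist_eq_norm]
    refine hb.trans_lt ?_
    have : 2 * (ε * R / 8) / (R / 2) = ε / 2 := by field_simp; ring
    rw [this]
    linarith
  have hconv : ∀ y ∈ Metric.ball x (R / 2), ∃ l,
      Tendsto (fun i => fderiv ℂ (G i) y) atTop (𝓝 l) := fun y hy =>
    cauchySeq_tendsto_of_complete (hcauchy.cauchySeq hy)
  choose! g' hg' using hconv
  have hxb : x ∈ Metric.ball x (R / 2) := Metric.mem_ball_self hR2
  have hd : HasFDerivAt g (g' x) x :=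
    hasFDerivAt_of_tendstoUniformlyOn Metric.isOpen_ball
      (hcauchy.tendstoUniformlyOn_of_tendsto hg')
      (fun n y hy => (hdiff n y (hballs y hy (Metric.mem_ball_self hR2))).hasFDerivAt)
      (fun y hy => hlim.tendsto_at (hsub (hballs y hy (Metric.mem_ball_self hR2)))) hxb
  exact ⟨hd.differentiableAt, hd.fderiv ▸ hg' x hxb⟩

/-- A holomorphic map on an open set is strictly differentiable there. -/
theorem hasStrictFDerivAt_of_differentiableOn [ProperSpace E] {Ω : Set E} (hΩ : IsOpen Ω)
    {f : E → F} (hf : DifferentiableOn ℂ f Ω) {x : E} (hx : x ∈ Ω) :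
    HasStrictFDerivAt f (fderiv ℂ f x) x := by
  have hd : ∀ y ∈ Ω, DifferentiableAt ℂ f y := fun y hy => hf.differentiableAt (hΩ.mem_nhds hy)
  refine hasStrictFDerivAt_of_hasFDerivAt_of_continuousAt
    ((hΩ.eventually_mem hx).mono fun y hy => (hd y hy).hasFDerivAt) ?_
  obtain ⟨R, hR, hsub⟩ := Metric.nhds_basis_closedBall.mem_iff.1 (hΩ.mem_nhds hx)
  have huc := (isCompact_closedBall x R).uniformContinuousOn_of_continuous
    (hf.continuousOn.mono hsub)
  rw [Metric.continuousAt_iff]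
  intro ε hε
  obtain ⟨δ, hδ, hfδ⟩ := Metric.uniformContinuousOn_iff.1 huc (ε * R / 8) (by positivity)
  refine ⟨min δ (R / 2), by positivity, fun {y} hy => ?_⟩
  have hyδ : dist y x < δ := hy.trans_le (min_le_left _ _)
  have hyR : dist y x < R / 2 := hy.trans_le (min_le_right _ _)
  have hmem : ∀ z ∈ Metric.ball x (R / 2), z ∈ Metric.closedBall x R ∧
      z + (y - x) ∈ Metric.closedBall x R := by
    intro z hz
    rw [Metric.mem_ball] at hz
    refine ⟨Metric.mem_closedBall.2 (by linarith), Metric.mem_closedBall.2 ?_⟩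
    rw [dist_eq_norm] at *
    calc ‖z + (y - x) - x‖ = ‖(z - x) + (y - x)‖ := by congr 1; abel
      _ ≤ ‖z - x‖ + ‖y - x‖ := norm_add_le _ _
      _ ≤ R := by linarith
  have hdt : ∀ z ∈ Metric.ball x (R / 2), DifferentiableAt ℂ (fun w => f (w + (y - x))) z :=
    fun z hz => (differentiableAt_comp_add_right _).2 (hd _ (hsub (hmem z hz).2))
  -- The Cauchy estimate for a translate of `f` minus `f` gives continuity of the derivative.
  have hb := norm_fderiv_le_of_norm_le_on_ball (f := (fun w => f (w + (y - x))) - f)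
    (M := ε * R / 8) (R := R / 2) (c := x) (by positivity)
    (fun z hz => ((hdt z hz).sub (hd z (hsub (hmem z hz).1))).differentiableWithinAt)
    (fun z hz => by
      have := hfδ _ (hmem z hz).2 _ (hmem z hz).1 (by
        rwa [dist_eq_norm, add_sub_cancel_left, ← dist_eq_norm])
      rw [dist_eq_norm] at this
      exact this.le)
  have hxb : x ∈ Metric.ball x (R / 2) := Metric.mem_ball_self (by positivity)
  rw [fderiv_sub (hdt x hxb) (hd x hx), fderiv_comp_add_right, add_sub_cancel] at hb
  rw [dist_eq_norm]
  refine hb.trans_lt ?_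
  have : 2 * (ε * R / 8) / (R / 2) = ε / 2 := by field_simp; ring
  rw [this]
  linarith

/-- The identity theorem on a convex open set. -/
theorem eqOn_of_convex_of_eventuallyEq [CompleteSpace F] {Ω : Set E} (hΩ : IsOpen Ω)
    (hconv : Convex ℝ Ω) {f g : E → F} (hf : DifferentiableOn ℂ f Ω)
    (hg : DifferentiableOn ℂ g Ω) {a : E} (ha : a ∈ Ω) (hfg : f =ᶠ[𝓝 a] g) : EqOn f g Ω := by
  intro w hw
  -- On the complex line through `a` and `w`, convexity makes the slice of `Ω` connected, and the
  -- one-variable identity theorem applies.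
  let L : ℂ → E := fun ζ => a + ζ • (w - a)
  have hL : Differentiable ℂ L := by fun_prop
  have hopen : IsOpen (L ⁻¹' Ω) := hΩ.preimage hL.continuous
  have hpre : IsPreconnected (L ⁻¹' Ω) := by
    refine Convex.isPreconnected fun ζ hζ ξ hξ s t hs ht hst => ?_
    have := hconv hζ hξ hs ht hst
    have heq : L (s • ζ + t • ξ) = s • L ζ + t • L ξ := by
      simp only [L]
      have hs' : s = 1 - t := by linarith
      subst hs'
      simp only [Complex.real_smul]
      module
    rwa [mem_preimage, heq]
  have h0 : (0 : ℂ) ∈ L ⁻¹' Ω := by simpa [L] using ha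
  have h1 : (1 : ℂ) ∈ L ⁻¹' Ω := by simpa [L] using hw
  have hfL : AnalyticOnNhd ℂ (f ∘ L) (L ⁻¹' Ω) :=
    (hf.comp hL.differentiableOn (mapsTo_preimage _ _)).analyticOnNhd hopen
  have hgL : AnalyticOnNhd ℂ (g ∘ L) (L ⁻¹' Ω) :=
    (hg.comp hL.differentiableOn (mapsTo_preimage _ _)).analyticOnNhd hopen
  have hL0 : Tendsto L (𝓝 0) (𝓝 a) := by
    simpa [L] using hL.continuous.tendsto 0
  have := hfL.eqOn_of_preconnected_of_eventuallyEq hgL hpre h0 (hL0.eventually hfg) h1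
  simpa [L] using this

/-- **Vitali's theorem** on a ball: a bounded sequence of holomorphic maps that converges
near one point to a holomorphic map converges to it everywhere. -/
theorem tendsto_of_norm_le_of_eventually_tendsto [ProperSpace E] [ProperSpace F] {c : E}
    {R M : ℝ} {G : ℕ → E → F} {g : E → F}
    (hG : ∀ i, DifferentiableOn ℂ (G i) (Metric.ball c R))
    (hM : ∀ᶠ i in atTop, ∀ y ∈ Metric.ball c R, ‖G i y‖ ≤ M)
    (hg : DifferentiableOn ℂ g (Metric.ball c R)) {a : E} (ha : a ∈ Metric.ball c R)
    (hlim : ∀ᶠ y in 𝓝 a, Tendsto (fun i => G i y) atTop (𝓝 (g y))) {w : E}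
    (hw : w ∈ Metric.ball c R) : Tendsto (fun i => G i w) atTop (𝓝 (g w)) := by
  obtain ⟨N, hN⟩ := eventually_atTop.1 hM
  -- Every subsequence has, by Montel, a convergent further one; its limit agrees with `g` near `a`,
  -- hence on the ball.
  refine tendsto_of_subseq_tendsto fun ns hns => ?_
  obtain ⟨N', hN'⟩ := eventually_atTop.1 (hns.eventually_ge_atTop N)
  obtain ⟨ψ, hψ, l, hl⟩ := exists_subseq_tendstoLocallyUniformlyOn (Metric.isOpen_ball (x := c)
    (ε := R)) (G := fun i => G (ns (i + N'))) (fun i => hG _) (fun x hx => by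
      obtain ⟨r, hr, hsub⟩ := Metric.mem_nhds_iff.1 (Metric.isOpen_ball.mem_nhds hx)
      exact ⟨r, hr, hsub, M, fun i y hy => hN _ (hN' _ (Nat.le_add_left _ _)) y (hsub hy)⟩)
  have hsub : Tendsto (fun i => ns (ψ i + N')) atTop atTop :=
    hns.comp ((tendsto_add_atTop_nat N').comp hψ.tendsto_atTop)
  have hld : DifferentiableOn ℂ l (Metric.ball c R) := fun x hx =>
    (differentiableAt_and_tendsto_fderiv_of_tendstoLocallyUniformlyOn Metric.isOpen_ball
      (fun i => hG _) hl hx).1.differentiableWithinAt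
  have heq : l =ᶠ[𝓝 a] g := by
    filter_upwards [hlim, Metric.isOpen_ball.mem_nhds ha] with y hy hyb
    exact tendsto_nhds_unique (hl.tendsto_at hyb) (hy.comp hsub)
  have hlw := eqOn_of_convex_of_eventuallyEq Metric.isOpen_ball (convex_ball c R) hld hg ha heq hw
  exact ⟨fun i => ψ i + N', hlw ▸ hl.tendsto_at hw⟩

end Holomorphic

/-! ### The Poincaré distance -/

theorem poincareDist_nonneg (a b : ℂ) : 0 ≤ poincareDist a b :=
  Real.artanh_nonneg (norm_nonneg _)

theorem poincareDist_comm (a b : ℂ) : poincareDist a b = poincareDist b a := by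
  have h : ‖1 - (starRingEnd ℂ) a * b‖ = ‖1 - (starRingEnd ℂ) b * a‖ := by
    rw [← Complex.norm_conj (1 - (starRingEnd ℂ) a * b)]
    simp [mul_comm]
  simp only [poincareDist, norm_div, h, norm_sub_rev a b]

/-- The automorphism of the unit disc taking `0` to `a`. -/
noncomputable def discAut (a w : ℂ) : ℂ := (w + a) / (1 + (starRingEnd ℂ) a * w)

theorem norm_conj_mul_lt_one {a w : ℂ} (ha : a ∈ Metric.ball (0 : ℂ) 1)
    (hw : w ∈ Metric.ball (0 : ℂ) 1) : ‖(starRingEnd ℂ) a * w‖ < 1 := by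
  rw [mem_ball_zero_iff] at ha hw
  rw [norm_mul, Complex.norm_conj]
  nlinarith [norm_nonneg a, norm_nonneg w]

theorem one_add_conj_mul_ne_zero {a w : ℂ} (ha : a ∈ Metric.ball (0 : ℂ) 1)
    (hw : w ∈ Metric.ball (0 : ℂ) 1) : 1 + (starRingEnd ℂ) a * w ≠ 0 := by
  intro h
  have h1 : (starRingEnd ℂ) a * w = -1 := by linear_combination h
  have := norm_conj_mul_lt_one ha hw
  simp [h1] at this

theorem normSq_lt_one {a : ℂ} (ha : a ∈ Metric.ball (0 : ℂ) 1) : Complex.normSq a < 1 := by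
  rw [mem_ball_zero_iff] at ha
  rw [Complex.normSq_eq_norm_sq]
  nlinarith [norm_nonneg a]

theorem discAut_mem_ball {a w : ℂ} (ha : a ∈ Metric.ball (0 : ℂ) 1)
    (hw : w ∈ Metric.ball (0 : ℂ) 1) : discAut a w ∈ Metric.ball (0 : ℂ) 1 := by
  have h0 := one_add_conj_mul_ne_zero ha hw
  rw [mem_ball_zero_iff, discAut, norm_div, div_lt_one (norm_pos_iff.2 h0)]
  refine lt_of_pow_lt_pow_left₀ 2 (norm_nonneg _) ?_
  rw [← Complex.normSq_eq_norm_sq, ← Complex.normSq_eq_norm_sq]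
  have h1 := normSq_lt_one ha
  have h2 := normSq_lt_one hw
  have h3 : Complex.normSq (1 + (starRingEnd ℂ) a * w) - Complex.normSq (w + a) =
      (1 - Complex.normSq a) * (1 - Complex.normSq w) := by
    simp only [Complex.normSq_apply, Complex.add_re, Complex.add_im, Complex.mul_re,
      Complex.mul_im, Complex.conj_re, Complex.conj_im, Complex.one_re, Complex.one_im]
    ring
  nlinarith

theorem differentiableOn_discAut {a : ℂ} (ha : a ∈ Metric.ball (0 : ℂ) 1) :
    DifferentiableOn ℂ (discAut a) (Metric.ball 0 1) := by
  intro w hw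
  have h0 := one_add_conj_mul_ne_zero ha hw
  unfold discAut
  have hn : DifferentiableAt ℂ (fun w : ℂ => w + a) w := by fun_prop
  have hd : DifferentiableAt ℂ (fun w : ℂ => 1 + (starRingEnd ℂ) a * w) w := by fun_prop
  exact (hn.fun_div hd h0).differentiableWithinAt

theorem discAut_zero (a : ℂ) : discAut a 0 = a := by simp [discAut]

theorem one_sub_conj_mul_self_ne_zero {a : ℂ} (ha : a ∈ Metric.ball (0 : ℂ) 1) :
    1 - (starRingEnd ℂ) a * a ≠ 0 := by
  intro h
  have h1 := norm_conj_mul_lt_one ha ha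
  rw [show (starRingEnd ℂ) a * a = 1 by linear_combination -h] at h1
  simp at h1

/-- Allows every disc of a chain to be recentred at `0`. -/
theorem poincareDist_discAut {a w : ℂ} (ha : a ∈ Metric.ball (0 : ℂ) 1)
    (hw : w ∈ Metric.ball (0 : ℂ) 1) : poincareDist a (discAut a w) = Real.artanh ‖w‖ := by
  have h0 := one_add_conj_mul_ne_zero ha hw
  have h1 := one_sub_conj_mul_self_ne_zero ha
  have h2 : 1 - (starRingEnd ℂ) a * ((w + a) / (1 + (starRingEnd ℂ) a * w)) =
      (1 - (starRingEnd ℂ) a * a) / (1 + (starRingEnd ℂ) a * w) := by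
    rw [eq_div_iff h0, sub_mul, mul_assoc, div_mul_cancel₀ _ h0]; ring
  have h3 : (a - (w + a) / (1 + (starRingEnd ℂ) a * w)) =
      -w * (1 - (starRingEnd ℂ) a * a) / (1 + (starRingEnd ℂ) a * w) := by
    rw [eq_div_iff h0, sub_mul, div_mul_cancel₀ _ h0]; ring
  have : (a - discAut a w) / (1 - (starRingEnd ℂ) a * discAut a w) = -w := by
    rw [discAut, h2, h3, div_div_div_cancel_right₀ h0, mul_div_cancel_right₀ _ h1]
  rw [poincareDist, this, norm_neg]

theorem exists_discAut_eq {a b : ℂ} (ha : a ∈ Metric.ball (0 : ℂ) 1)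
    (hb : b ∈ Metric.ball (0 : ℂ) 1) : ∃ w ∈ Metric.ball (0 : ℂ) 1, discAut a w = b := by
  have ha' : -a ∈ Metric.ball (0 : ℂ) 1 := by simpa using ha
  refine ⟨discAut (-a) b, discAut_mem_ball ha' hb, ?_⟩
  have h0 := one_add_conj_mul_ne_zero ha' hb
  have h2 := one_add_conj_mul_ne_zero ha (discAut_mem_ball ha' hb)
  rw [discAut, div_eq_iff h2]
  have h3 : discAut (-a) b * (1 + (starRingEnd ℂ) (-a) * b) = b + -a := div_mul_cancel₀ _ h0
  refine mul_right_cancel₀ h0 ?_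
  rw [map_neg] at h3 ⊢
  linear_combination (1 - (starRingEnd ℂ) a * b) * h3

/-- From `log t ≥ 1 - 1 / t` at `t = (1 + x) / (1 - x)`; it turns Poincaré lengths into Euclidean
bounds. -/
theorem half_le_artanh {x : ℝ} (h0 : 0 ≤ x) (h1 : x < 1) : x / 2 ≤ Real.artanh x := by
  rw [Real.artanh_eq_half_log ⟨by linarith, h1.le⟩]
  have hx : 0 < 1 - x := by linarith
  have h := Real.one_sub_inv_le_log_of_pos (x := (1 + x) / (1 - x)) (by positivity)
  have h2 : x ≤ 1 - ((1 + x) / (1 - x))⁻¹ := by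
    rw [inv_div, le_sub_iff_add_le, ← le_sub_iff_add_le', div_le_iff₀ (by linarith)]
    nlinarith
  linarith

/-! ### The Kobayashi pseudodistance -/

section Kobayashi

variable {k : ℕ} {U V : Set (Ck k)}

theorem KobayashiChain.nonneg {x y : Ck k} {ℓ : ℝ} (h : KobayashiChain U x y ℓ) : 0 ≤ ℓ := by
  induction h with
  | nil x hx => exact le_rfl
  | cons φ hφ hφU a b ha hb z ℓ h ih => exact add_nonneg (poincareDist_nonneg a b) ih

theorem KobayashiChain.trans {x y z : Ck k} {ℓ ℓ' : ℝ} (h : KobayashiChain U x y ℓ)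
    (h' : KobayashiChain U y z ℓ') : KobayashiChain U x z (ℓ + ℓ') := by
  induction h with
  | nil x hx => simpa using h'
  | cons φ hφ hφU a b ha hb w ℓ h ih =>
    rw [add_assoc]
    exact .cons φ hφ hφU a b ha hb z _ (ih h')

theorem KobayashiChain.disc {φ : ℂ → Ck k} (hφ : DifferentiableOn ℂ φ (Metric.ball 0 1))
    (hφU : MapsTo φ (Metric.ball 0 1) U) {a b : ℂ} (ha : a ∈ Metric.ball (0 : ℂ) 1)
    (hb : b ∈ Metric.ball (0 : ℂ) 1) : KobayashiChain U (φ a) (φ b) (poincareDist a b) := by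
  simpa using KobayashiChain.cons φ hφ hφU a b ha hb _ 0 (.nil _ (hφU hb))

theorem KobayashiChain.symm {x y : Ck k} {ℓ : ℝ} (h : KobayashiChain U x y ℓ) :
    KobayashiChain U y x ℓ := by
  induction h with
  | nil x hx => exact .nil x hx
  | cons φ hφ hφU a b ha hb z ℓ h ih =>
    rw [add_comm, poincareDist_comm]
    exact ih.trans (.disc hφ hφU hb ha)

theorem KobayashiChain.map {f : Ck k → Ck k} (hf : DifferentiableOn ℂ f V) (hfV : MapsTo f V U)
    {x y : Ck k} {ℓ : ℝ} (h : KobayashiChain V x y ℓ) : KobayashiChain U (f x) (f y) ℓ := by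
  induction h with
  | nil x hx => exact .nil _ (hfV hx)
  | cons φ hφ hφU a b ha hb z ℓ h ih =>
    exact .cons (f ∘ φ) (hf.comp hφ hφU) (hfV.comp hφU) a b ha hb _ _ ih

theorem KobayashiChain.kobayashiDist_le {x y : Ck k} {ℓ : ℝ} (h : KobayashiChain U x y ℓ) :
    kobayashiDist U x y ≤ ENNReal.ofReal ℓ :=
  iInf₂_le ℓ h

theorem exists_kobayashiChain_of_kobayashiDist_lt {x y : Ck k} {ε : ℝ≥0∞}
    (h : kobayashiDist U x y < ε) : ∃ ℓ, KobayashiChain U x y ℓ ∧ ENNReal.ofReal ℓ < ε := by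
  simpa only [kobayashiDist, iInf_lt_iff, exists_prop] using h

theorem kobayashiDist_comm (x y : Ck k) : kobayashiDist U x y = kobayashiDist U y x :=
  le_antisymm (le_iInf₂ fun _ h => h.symm.kobayashiDist_le)
    (le_iInf₂ fun _ h => h.symm.kobayashiDist_le)

theorem kobayashiDist_triangle (x y z : Ck k) :
    kobayashiDist U x z ≤ kobayashiDist U x y + kobayashiDist U y z := by
  simp only [kobayashiDist, ENNReal.iInf_add, ENNReal.add_iInf]
  refine le_iInf₂ fun ℓ h => le_iInf₂ fun ℓ' h' => ?_
  rw [← ENNReal.ofReal_add]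
  · exact (h'.trans h).kobayashiDist_le
  all_goals first | exact h.nonneg | exact h'.nonneg

theorem kobayashiDist_map_le {f : Ck k → Ck k} (hf : DifferentiableOn ℂ f V)
    (hfV : MapsTo f V U) (x y : Ck k) :
    kobayashiDist U (f x) (f y) ≤ kobayashiDist V x y :=
  le_iInf₂ fun _ h => (h.map hf hfV).kobayashiDist_le

theorem kobayashiDist_mono (h : V ⊆ U) (x y : Ck k) :
    kobayashiDist U x y ≤ kobayashiDist V x y :=
  kobayashiDist_map_le (f := id) differentiableOn_id h x y

theorem IsKobayashiHyperbolic.mono (hU : IsKobayashiHyperbolic U) (h : V ⊆ U) :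
    IsKobayashiHyperbolic V := fun x hx y hy hxy =>
  (hU x (h hx) y (h hy) hxy).trans_le (kobayashiDist_mono h x y)

/-- Uses the affine disc of radius `r` centred at `x` in the direction of `y`. -/
theorem kobayashiDist_le_of_ball_subset {x y : Ck k} {r : ℝ} (h : Metric.ball x r ⊆ U)
    (hy : y ∈ Metric.ball x r) :
    kobayashiDist U x y ≤ ENNReal.ofReal (Real.artanh (dist y x / r)) := by
  have hr : 0 < r := Metric.nonempty_ball.1 ⟨y, hy⟩
  rcases eq_or_ne y x with rfl | hne
  · simpa using (KobayashiChain.nil y (h hy)).kobayashiDist_le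
  have hd : 0 < dist y x := dist_pos.2 hne
  let φ : ℂ → Ck k := fun ζ => x + ζ • ((r / dist y x : ℝ) : ℂ) • (y - x)
  have hφ : Differentiable ℂ φ := by fun_prop
  have hφU : MapsTo φ (Metric.ball 0 1) U := by
    intro ζ hζ
    rw [mem_ball_zero_iff] at hζ
    apply h
    rw [Metric.mem_ball, dist_eq_norm, add_sub_cancel_left, norm_smul, norm_smul,
      Complex.norm_real, Real.norm_of_nonneg (by positivity), ← dist_eq_norm,
      div_mul_cancel₀ _ hd.ne']
    nlinarith
  have hb : ((dist y x / r : ℝ) : ℂ) ∈ Metric.ball (0 : ℂ) 1 := by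
    rw [mem_ball_zero_iff, Complex.norm_real, Real.norm_of_nonneg (by positivity),
      div_lt_one hr]
    exact hy
  have hc := (KobayashiChain.disc hφ.differentiableOn hφU (Metric.mem_ball_self one_pos)
    hb).kobayashiDist_le
  have h0 : φ 0 = x := by simp [φ]
  have h1 : φ ((dist y x / r : ℝ) : ℂ) = y := by
    simp only [φ, smul_smul, ← Complex.ofReal_mul]
    rw [div_mul_div_cancel₀ hr.ne', div_self hd.ne']
    simp
  rw [h0, h1] at hc
  refine hc.trans_eq ?_
  congr 1
  simp only [poincareDist, zero_sub, map_zero, zero_mul, sub_zero, div_one, norm_neg]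
  rw [Complex.norm_real, Real.norm_of_nonneg (by positivity)]

/-- The Kobayashi pseudodistance of an open set is small at small Euclidean scales. -/
theorem eventually_kobayashiDist_lt (hU : IsOpen U) {x : Ck k} (hx : x ∈ U) {ε : ℝ≥0∞}
    (hε : 0 < ε) : ∀ᶠ y in 𝓝 x, kobayashiDist U x y < ε := by
  obtain ⟨r, hr, hsub⟩ := Metric.mem_nhds_iff.1 (hU.mem_nhds hx)
  have hcont : ContinuousAt (fun y => ENNReal.ofReal (Real.artanh (dist y x / r))) x := by
    refine ENNReal.continuous_ofReal.continuousAt.comp ?_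
    have : ContinuousAt Real.artanh (dist x x / r) := by
      simp only [dist_self, zero_div]
      unfold Real.artanh
      exact ContinuousAt.log (by fun_prop (disch := norm_num)) (by norm_num)
    exact ContinuousAt.comp (f := fun y => dist y x / r) this (by fun_prop)
  have hlt := hcont.eventually_lt (continuousAt_const (y := ε)) (by simpa using hε)
  filter_upwards [hlt, Metric.ball_mem_nhds x hr] with y hy hyb
  exact (kobayashiDist_le_of_ball_subset hsub hyb).trans_lt hy

theorem IsPreconnected.inter_frontier_nonempty {X : Type*} [TopologicalSpace X]
    {t B : Set X} (ht : IsPreconnected t) (h1 : (t ∩ B).Nonempty) (h2 : (t ∩ Bᶜ).Nonempty) :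
    (t ∩ frontier B).Nonempty := by
  by_contra hne
  have hnf : ∀ z ∈ t, z ∉ frontier B := fun z hz hzf => hne ⟨z, hz, hzf⟩
  obtain ⟨x, hxt, hxB⟩ := h1
  obtain ⟨y, hyt, hyB⟩ := h2
  have hcover : t ⊆ interior B ∪ (closure B)ᶜ := fun z hz => by
    by_cases hzc : z ∈ closure B
    · exact Or.inl (by_contra fun hzi => hnf z hz ⟨hzc, hzi⟩)
    · exact Or.inr hzc
  obtain ⟨z, -, hzi, hzc⟩ := ht _ _ isOpen_interior isClosed_closure.isOpen_compl hcover
    ⟨x, hxt, (hcover hxt).resolve_right fun h => h (subset_closure hxB)⟩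
    ⟨y, hyt, (hcover hyt).resolve_left fun h => hyB (interior_subset h)⟩
  exact hzc (subset_closure (interior_subset hzi))

/-- A chain leaving an open set has a subchain ending on its frontier. -/
theorem KobayashiChain.exists_mem_frontier {B : Set (Ck k)} {x y : Ck k} {ℓ : ℝ}
    (h : KobayashiChain U x y ℓ) (hx : x ∈ B) (hy : y ∉ B) :
    ∃ s ∈ frontier B, ∃ ℓ' ≤ ℓ, KobayashiChain U x s ℓ' := by
  induction h with
  | nil x _ => exact absurd hx hy
  | cons φ hφ hφU a b ha hb z ℓ h ih =>
    by_cases hbB : φ b ∈ B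
    · obtain ⟨s, hs, ℓ', hℓ', hch⟩ := ih hbB hy
      exact ⟨s, hs, _, by gcongr, .cons φ hφ hφU a b ha hb s ℓ' hch⟩
    -- With `φ a` at the centre, the image of the closed disc of radius `‖w‖` is connected and meets
    -- the frontier at some `v`; `‖v‖ ≤ ‖w‖` keeps the chain short.
    · obtain ⟨w, hw, rfl⟩ := exists_discAut_eq ha hb
      have hw1 : ‖w‖ < 1 := mem_ball_zero_iff.1 hw
      have hsub : Metric.closedBall (0 : ℂ) ‖w‖ ⊆ Metric.ball 0 1 :=
        Metric.closedBall_subset_ball hw1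
      have hcont : ContinuousOn (φ ∘ discAut a) (Metric.closedBall 0 ‖w‖) :=
        (hφ.comp (differentiableOn_discAut ha)
          fun v hv => discAut_mem_ball ha hv).continuousOn.mono hsub
      have hpre : IsPreconnected ((φ ∘ discAut a) '' Metric.closedBall 0 ‖w‖) :=
        (convex_closedBall (0 : ℂ) ‖w‖).isPreconnected.image _ hcont
      obtain ⟨s, ⟨v, hv, rfl⟩, hs⟩ := hpre.inter_frontier_nonempty
        ⟨φ a, ⟨0, by simp, by simp [discAut_zero]⟩, hx⟩
        ⟨φ (discAut a w), ⟨w, by simp, rfl⟩, hbB⟩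
      refine ⟨_, hs, _, ?_, KobayashiChain.disc hφ hφU ha (discAut_mem_ball ha (hsub hv))⟩
      rw [poincareDist_discAut ha (hsub hv), poincareDist_discAut ha hw]
      have h1 : ‖v‖ ≤ ‖w‖ := by simpa using hv
      have h2 := Real.artanh_le_artanh (by linarith [norm_nonneg v]) hw1 h1
      linarith [h.nonneg]

/-- **Barth's theorem**: the Kobayashi distance of a hyperbolic open set induces the Euclidean
topology. -/
theorem IsKobayashiHyperbolic.exists_dist_lt (hU : IsOpen U) (hyp : IsKobayashiHyperbolic U)
    {x : Ck k} (hx : x ∈ U) {r : ℝ} (hr : 0 < r) :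
    ∃ δ : ℝ≥0∞, 0 < δ ∧ ∀ y, kobayashiDist U x y < δ → dist y x < r := by
  obtain ⟨R, hR, hsub⟩ := Metric.nhds_basis_closedBall.mem_iff.1 (hU.mem_nhds hx)
  set t := min r R with ht
  have htpos : 0 < t := lt_min hr hR
  -- Near each `s` on the sphere the distance from `x` is at least half of that to `s`; compactness
  -- makes the bound uniform.
  have hS : ∃ δ : ℝ≥0∞, 0 < δ ∧ ∀ s ∈ Metric.sphere x t, δ ≤ kobayashiDist U x s := by
    refine (isCompact_sphere x t).induction_on
      (p := fun A => ∃ δ : ℝ≥0∞, 0 < δ ∧ ∀ s ∈ A, δ ≤ kobayashiDist U x s) ?_ ?_ ?_ ?_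
    · exact ⟨1, one_pos, by simp⟩
    · rintro A B hAB ⟨δ, hδ, h⟩
      exact ⟨δ, hδ, fun s hs => h s (hAB hs)⟩
    · rintro A B ⟨δ, hδ, h⟩ ⟨δ', hδ', h'⟩
      refine ⟨min δ δ', lt_min hδ hδ', ?_⟩
      rintro s (hs | hs)
      · exact (min_le_left _ _).trans (h s hs)
      · exact (min_le_right _ _).trans (h' s hs)
    · intro s hs
      have hsd : dist s x = t := hs
      have hsU : s ∈ U := hsub (Metric.mem_closedBall.2 (hsd.trans_le (min_le_right _ _)))
      have hne : x ≠ s := by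
        rintro rfl
        simp at hsd
        exact htpos.ne hsd
      have hpos := ENNReal.half_pos (hyp x hx s hsU hne).ne'
      refine ⟨_, nhdsWithin_le_nhds (eventually_kobayashiDist_lt hU hsU hpos), _, hpos, ?_⟩
      intro s' hs'
      by_contra! hlt
      have := (kobayashiDist_triangle (U := U) x s' s).trans_lt
        (ENNReal.add_lt_add hlt ((kobayashiDist_comm s' s).trans_lt hs'))
      rw [ENNReal.add_halves] at this
      exact lt_irrefl _ this
  obtain ⟨δ, hδ, hSδ⟩ := hS
  refine ⟨δ, hδ, fun y hy => ?_⟩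
  by_contra! hyr
  -- A short chain to a far point would reach the sphere with length below `δ`.
  obtain ⟨ℓ, hch, hℓ⟩ := exists_kobayashiChain_of_kobayashiDist_lt hy
  obtain ⟨s, hs, ℓ', hℓ', hch'⟩ := hch.exists_mem_frontier (B := Metric.ball x t)
    (Metric.mem_ball_self htpos) (fun h => by
      have := Metric.mem_ball.1 h
      exact absurd (this.trans_le (min_le_left _ _)) (not_lt.2 hyr))
  have := (hSδ s (Metric.frontier_ball_subset_sphere hs)).trans hch'.kobayashiDist_le
  exact absurd (this.trans (ENNReal.ofReal_le_ofReal hℓ')) (not_le.2 hℓ)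

/-- Schwarz on each recentred disc bounds its step by `M * ‖w‖`, and `‖w‖` is at most twice its
Poincaré length. -/
theorem KobayashiChain.dist_le {M : ℝ} (hM : ∀ x ∈ U, ∀ y ∈ U, dist x y ≤ M) {x y : Ck k} {ℓ : ℝ}
    (h : KobayashiChain U x y ℓ) : dist x y ≤ 2 * M * ℓ := by
  induction h with
  | nil x hx => simp
  | cons φ hφ hφU a b ha hb z ℓ h ih =>
    have hM0 : 0 ≤ M := dist_nonneg.trans (hM _ (hφU ha) _ (hφU hb))
    obtain ⟨w, hw, rfl⟩ := exists_discAut_eq ha hb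
    have hw1 : ‖w‖ < 1 := mem_ball_zero_iff.1 hw
    have hs := Complex.dist_le_div_mul_dist_of_mapsTo_ball (f := φ ∘ discAut a) (R₂ := M)
      (hφ.comp (differentiableOn_discAut ha) fun v hv => discAut_mem_ball ha hv)
      (fun v hv => Metric.mem_closedBall.2 (hM _ (hφU (discAut_mem_ball ha hv)) _
        (hφU (discAut_mem_ball ha (Metric.mem_ball_self one_pos))))) hw
    simp only [Function.comp_apply, discAut_zero, div_one, dist_zero_right] at hs
    have hart := half_le_artanh (norm_nonneg w) hw1
    rw [← poincareDist_discAut ha hw] at hart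
    have htri := dist_triangle (φ a) (φ (discAut a w)) z
    rw [dist_comm] at hs
    nlinarith

theorem isKobayashiHyperbolic_of_isBounded (hU : Bornology.IsBounded U) :
    IsKobayashiHyperbolic U := by
  intro x hx y hy hxy
  obtain ⟨M, hM⟩ := Metric.isBounded_iff.1 hU
  have hd : 0 < dist x y := dist_pos.2 hxy
  have hM0 : 0 < M := hd.trans_le (hM hx hy)
  have : ENNReal.ofReal (dist x y / (2 * M)) ≤ kobayashiDist U x y := by
    refine le_iInf₂ fun ℓ h => ENNReal.ofReal_le_ofReal ?_
    rw [div_le_iff₀ (by positivity), mul_comm]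
    exact h.dist_le fun x hx y hy => hM hx hy
  exact (ENNReal.ofReal_pos.2 (by positivity)).trans_le this

/-- Convergence for the Kobayashi distance of a hyperbolic open set implies convergence. -/
theorem IsKobayashiHyperbolic.tendsto_of_tendsto_kobayashiDist (hU : IsOpen U)
    (hyp : IsKobayashiHyperbolic U) {x : Ck k} (hx : x ∈ U) {ι : Type*} {l : Filter ι}
    {u : ι → Ck k} (h : ∀ ε : ℝ≥0∞, 0 < ε → ∀ᶠ i in l, kobayashiDist U x (u i) < ε) :
    Tendsto u l (𝓝 x) := by
  rw [Metric.tendsto_nhds]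
  intro r hr
  obtain ⟨δ, hδ, hd⟩ := hyp.exists_dist_lt hU hx hr
  exact (h δ hδ).mono fun i hi => hd _ hi

end Kobayashi

/-! ### Iterates of a holomorphic self-map of a hyperbolic open set -/

theorem ENNReal.exists_pos_add_add_add_le {δ : ℝ≥0∞} (hδ : 0 < δ) :
    ∃ ε : ℝ≥0∞, 0 < ε ∧ ε + ε + (ε + ε) ≤ δ := by
  refine ⟨δ / 2 / 2, ENNReal.half_pos (ENNReal.half_pos hδ.ne').ne', ?_⟩
  rw [ENNReal.add_halves, ENNReal.add_halves]

section Dynamics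

variable {k : ℕ} {V : Set (Ck k)} {f : Ck k → Ck k}

theorem kobayashiDist_self {x : Ck k} (hx : x ∈ V) : kobayashiDist V x x = 0 := by
  simpa using (KobayashiChain.nil x hx).kobayashiDist_le

theorem DifferentiableOn.iterate_of_mapsTo (hf : DifferentiableOn ℂ f V) (hfV : MapsTo f V V)
    (n : ℕ) : DifferentiableOn ℂ f^[n] V := by
  induction n with
  | zero => exact differentiableOn_id
  | succ n ih => exact ih.comp hf hfV

theorem kobayashiDist_iterate_le (hf : DifferentiableOn ℂ f V) (hfV : MapsTo f V V) (n : ℕ)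
    (x y : Ck k) : kobayashiDist V (f^[n] x) (f^[n] y) ≤ kobayashiDist V x y :=
  kobayashiDist_map_le (hf.iterate_of_mapsTo hfV n) (hfV.iterate n) x y

theorem isOpen_image_iterate (hfo : ∀ O ⊆ V, IsOpen O → IsOpen (f '' O)) (hfV : MapsTo f V V)
    (n : ℕ) : ∀ O ⊆ V, IsOpen O → IsOpen (f^[n] '' O) := by
  induction n with
  | zero => intro O _ hO; simpa using hO
  | succ n ih =>
    intro O hOV hO
    rw [Function.iterate_succ, image_comp]
    exact ih _ (hfV.mono_left hOV).image_subset (hfo O hOV hO)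

/-- The orbit of a recurrent point is relatively compact. -/
theorem IsRecurrentPoint.exists_isCompact (hV : IsOpen V) (hyp : IsKobayashiHyperbolic V)
    (hf : DifferentiableOn ℂ f V) (hfV : MapsTo f V V) {p : Ck k} (hp : p ∈ V)
    (hrec : IsRecurrentPoint f p) : ∃ K ⊆ V, IsCompact K ∧ ∀ n, f^[n] p ∈ K := by
  obtain ⟨R, hR, hsub⟩ := Metric.nhds_basis_closedBall.mem_iff.1 (hV.mem_nhds hp)
  obtain ⟨δ, hδ, hδR⟩ := hyp.exists_dist_lt hV hp hR
  obtain ⟨ε, hε, hεδ⟩ := ENNReal.exists_pos_add_add_add_le hδ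
  obtain ⟨r, hr, hrlim⟩ := hrec
  set A : Set (Ck k) := {y | (∃ n, f^[n] p = y) ∧ kobayashiDist V p y < δ} with hA
  have hAsub : closure A ⊆ Metric.closedBall p R :=
    closure_minimal (fun y hy => (hδR y hy.2).le) Metric.isClosed_closedBall
  have hAc : IsCompact (closure A) := (isCompact_closedBall p R).of_isClosed_subset
    isClosed_closure hAsub
  -- Near an orbit point `f^[n] p`, the time `r i - n` works for all points at once, by
  -- nonexpansion; compactness bounds the return times by `T`.
  have hret : ∃ T, ∀ y ∈ closure A, ∃ t, 1 ≤ t ∧ t ≤ T ∧ kobayashiDist V p (f^[t] y) < δ := by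
    refine hAc.induction_on
      (p := fun S => ∃ T, ∀ y ∈ S, ∃ t, 1 ≤ t ∧ t ≤ T ∧ kobayashiDist V p (f^[t] y) < δ)
      ⟨0, by simp⟩ ?_ ?_ ?_
    · rintro S S' hSS ⟨T, hT⟩
      exact ⟨T, fun y hy => hT y (hSS hy)⟩
    · rintro S S' ⟨T, hT⟩ ⟨T', hT'⟩
      refine ⟨max T T', ?_⟩
      rintro y (hy | hy)
      · obtain ⟨t, h1, h2, h3⟩ := hT y hy
        exact ⟨t, h1, h2.trans (le_max_left _ _), h3⟩
      · obtain ⟨t, h1, h2, h3⟩ := hT' y hy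
        exact ⟨t, h1, h2.trans (le_max_right _ _), h3⟩
    · intro y hy
      have hyV : y ∈ V := hsub (hAsub hy)
      have hN := eventually_kobayashiDist_lt hV hyV hε
      obtain ⟨_, hyn, ⟨n, rfl⟩, -⟩ := mem_closure_iff_nhds.1 hy _ hN
      obtain ⟨i, hi, hin⟩ := ((hrlim.eventually (eventually_kobayashiDist_lt hV hp hε)).and
        (hr.tendsto_atTop.eventually_gt_atTop n)).exists
      refine ⟨_, nhdsWithin_le_nhds hN, r i - n, fun z hz => ⟨r i - n, by omega, le_rfl, ?_⟩⟩
      have hsplit : f^[r i] p = f^[r i - n] (f^[n] p) := by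
        rw [← Function.iterate_add_apply, Nat.sub_add_cancel hin.le]
      calc kobayashiDist V p (f^[r i - n] z)
          ≤ kobayashiDist V p (f^[r i] p) +
            kobayashiDist V (f^[r i] p) (f^[r i - n] z) := kobayashiDist_triangle _ _ _
        _ ≤ kobayashiDist V p (f^[r i] p) + kobayashiDist V (f^[n] p) z := by
            rw [hsplit]
            gcongr
            exact kobayashiDist_iterate_le hf hfV _ _ _
        _ ≤ kobayashiDist V p (f^[r i] p) +
            (kobayashiDist V y (f^[n] p) + kobayashiDist V y z) := by
            gcongr
            rw [kobayashiDist_comm y]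
            exact kobayashiDist_triangle _ _ _
        _ < ε + (ε + ε) := ENNReal.add_lt_add hi (ENNReal.add_lt_add hyn hz)
        _ ≤ δ := le_trans (by gcongr; exact le_self_add) hεδ
  obtain ⟨T, hT⟩ := hret
  have hsynd : ∀ n, ∃ a b, b ≤ T ∧ a + b = n ∧ kobayashiDist V p (f^[a] p) < δ := by
    intro n
    induction n with
    | zero => exact ⟨0, 0, Nat.zero_le _, rfl, by simpa [kobayashiDist_self hp] using hδ⟩
    | succ n ih =>
      obtain ⟨a, b, hb, hab, ha⟩ := ih
      rcases hb.lt_or_eq with hlt | rfl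
      · exact ⟨a, b + 1, hlt, by omega, ha⟩
      -- Here the delay has reached `T`; a return after `t ≥ 1` steps brings it down to `T + 1 - t ≤
      -- T`.
      · obtain ⟨t, h1, h2, h3⟩ := hT _ (subset_closure ⟨⟨a, rfl⟩, ha⟩)
        rw [← Function.iterate_add_apply] at h3
        exact ⟨t + a, b + 1 - t, by omega, by omega, h3⟩
  refine ⟨⋃ b ∈ Finset.range (T + 1), f^[b] '' closure A, ?_, ?_, ?_⟩
  · refine iUnion₂_subset fun b _ => ?_
    exact ((hfV.iterate b).mono_left (hAsub.trans hsub)).image_subset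
  · exact (Finset.range (T + 1)).isCompact_biUnion fun b _ => hAc.image_of_continuousOn
      ((hf.iterate_of_mapsTo hfV b).continuousOn.mono (hAsub.trans hsub))
  · intro n
    obtain ⟨a, b, hb, rfl, ha⟩ := hsynd n
    refine mem_iUnion₂.2 ⟨b, Finset.mem_range.2 (by omega), f^[a] p,
      subset_closure ⟨⟨a, rfl⟩, ha⟩, ?_⟩
    rw [← Function.iterate_add_apply, add_comm]

/-- Iterates that converge to the identity at points close to `z` are bounded near `z`. -/
theorem eventually_norm_iterate_le (hV : IsOpen V) (hyp : IsKobayashiHyperbolic V)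
    (hf : DifferentiableOn ℂ f V) (hfV : MapsTo f V V) {m : ℕ → ℕ} {z : Ck k} (hz : z ∈ V)
    (hcl : z ∈ closure {w | Tendsto (fun i => f^[m i] w) atTop (𝓝 w)}) :
    ∃ s > 0, Metric.ball z s ⊆ V ∧
      ∀ᶠ i in atTop, ∀ w ∈ Metric.ball z s, ‖f^[m i] w‖ ≤ ‖z‖ + 1 := by
  obtain ⟨δ, hδ, hδ1⟩ := hyp.exists_dist_lt hV hz one_pos
  obtain ⟨ε, hε, hεδ⟩ := ENNReal.exists_pos_add_add_add_le hδ
  obtain ⟨s, hs, hsub⟩ := Metric.mem_nhds_iff.1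
    (inter_mem (hV.mem_nhds hz) (eventually_kobayashiDist_lt hV hz hε))
  refine ⟨s, hs, fun w hw => (hsub hw).1, ?_⟩
  -- Nonexpansion compares `f^[m i] w` with `f^[m i] a`, which tends to `a`, a point close to `z`.
  obtain ⟨a, has, ha⟩ := mem_closure_iff_nhds.1 hcl _ (Metric.ball_mem_nhds z hs)
  have haz : kobayashiDist V z a < ε := (hsub has).2
  filter_upwards [ha.eventually (eventually_kobayashiDist_lt hV (hsub has).1 hε)] with i hi w hw
  have hwz : kobayashiDist V z w < ε := (hsub hw).2
  have hd : dist (f^[m i] w) z < 1 := by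
    apply hδ1
    calc kobayashiDist V z (f^[m i] w)
        ≤ kobayashiDist V z (f^[m i] a) + kobayashiDist V (f^[m i] a) (f^[m i] w) :=
          kobayashiDist_triangle _ _ _
      _ ≤ (kobayashiDist V z a + kobayashiDist V a (f^[m i] a)) +
          (kobayashiDist V z a + kobayashiDist V z w) := by
          gcongr
          · exact kobayashiDist_triangle _ _ _
          · refine (kobayashiDist_iterate_le hf hfV _ _ _).trans ?_
            rw [kobayashiDist_comm z a]
            exact kobayashiDist_triangle _ _ _
      _ < ε + ε + (ε + ε) :=
          ENNReal.add_lt_add (ENNReal.add_lt_add haz hi) (ENNReal.add_lt_add haz hwz)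
      _ ≤ δ := hεδ
  rw [dist_eq_norm] at hd
  linarith [norm_le_norm_add_norm_sub' (f^[m i] w) z]

/-- Iterates that converge to the identity on an open subset of a connected open set `W` converge
to it locally uniformly on `W`. -/
theorem tendstoLocallyUniformlyOn_iterate_id (hV : IsOpen V) (hyp : IsKobayashiHyperbolic V)
    (hf : DifferentiableOn ℂ f V) (hfV : MapsTo f V V) {W : Set (Ck k)} (hW : IsOpen W)
    (hWc : IsPreconnected W) (hWV : W ⊆ V) {m : ℕ → ℕ} {z₀ : Ck k} (hz₀ : z₀ ∈ W)
    (hlim : ∀ᶠ z in 𝓝 z₀, Tendsto (fun i => f^[m i] z) atTop (𝓝 z)) :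
    TendstoLocallyUniformlyOn (fun i => f^[m i]) id atTop W := by
  set L : Set (Ck k) := {w | Tendsto (fun i => f^[m i] w) atTop (𝓝 w)} with hL
  -- The interior of `L` is relatively closed in `W`: at a limit point the iterates are locally
  -- bounded and Vitali applies with limit `id`.
  have hWL : W ⊆ interior L := by
    refine hWc.subset_of_closure_inter_subset isOpen_interior
      ⟨z₀, hz₀, mem_interior_iff_mem_nhds.2 hlim⟩ ?_
    rintro z ⟨hzL, hzW⟩
    obtain ⟨s, hs, hsub, hbd⟩ := eventually_norm_iterate_le hV hyp hf hfV (hWV hzW)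
      (closure_mono interior_subset hzL)
    obtain ⟨a, has, ha⟩ := mem_closure_iff_nhds.1 hzL _ (Metric.ball_mem_nhds z hs)
    rw [mem_interior_iff_mem_nhds] at ha ⊢
    filter_upwards [Metric.ball_mem_nhds z hs] with w hw
    exact tendsto_of_norm_le_of_eventually_tendsto (g := id)
      (fun i => (hf.iterate_of_mapsTo hfV _).mono hsub) hbd differentiableOn_id has ha hw
  refine tendstoLocallyUniformlyOn_of_tendsto_of_equicontinuous hW (fun x hx ε hε => ?_)
    fun x hx => interior_subset (hWL hx)
  obtain ⟨s, hs, hsub, hbd⟩ := eventually_norm_iterate_le hV hyp hf hfV (hWV hx)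
    (subset_closure (interior_subset (hWL hx)))
  exact eventually_dist_lt_of_norm_le_on_ball hs hsub
    (fun i => hf.iterate_of_mapsTo hfV (m i)) hbd hε

/-- Iterates map components into components. -/
theorem mapsTo_iterate_connectedComponentIn (hf : DifferentiableOn ℂ f V) (hfV : MapsTo f V V)
    {z : Ck k} (hz : z ∈ V) (n : ℕ) :
    MapsTo f^[n] (connectedComponentIn V z) (connectedComponentIn V (f^[n] z)) := by
  rw [mapsTo_iff_image_subset]
  refine IsPreconnected.subset_connectedComponentIn ?_ ?_ ?_
  · exact isPreconnected_connectedComponentIn.image _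
      ((hf.iterate_of_mapsTo hfV n).continuousOn.mono (connectedComponentIn_subset V z))
  · exact mem_image_of_mem _ (mem_connectedComponentIn hz)
  · exact ((hfV.iterate n).mono_left (connectedComponentIn_subset V z)).image_subset

theorem mapsTo_iterate_component_of_mem (hf : DifferentiableOn ℂ f V) (hfV : MapsTo f V V)
    {p z : Ck k} {n : ℕ} (hz : z ∈ connectedComponentIn V p)
    (hnz : f^[n] z ∈ connectedComponentIn V p) :
    MapsTo f^[n] (connectedComponentIn V p) (connectedComponentIn V p) := by
  have h := mapsTo_iterate_connectedComponentIn hf hfV (connectedComponentIn_subset V p hz) n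
  rwa [← connectedComponentIn_eq hz, ← connectedComponentIn_eq hnz] at h

/-- Limit points may lie in other components of `V`; arbitrarily late returns of `W` bring them
back. -/
theorem IsRecurrentPoint.exists_mapsTo_component (hV : IsOpen V) (hf : DifferentiableOn ℂ f V)
    (hfV : MapsTo f V V) {p : Ck k} (hp : p ∈ V) (hrec : IsRecurrentPoint f p) (N : ℕ) :
    ∃ M ≥ N, MapsTo f^[M] (connectedComponentIn V p) (connectedComponentIn V p) := by
  obtain ⟨r, hr, hlim⟩ := hrec
  have hpW : p ∈ connectedComponentIn V p := mem_connectedComponentIn hp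
  obtain ⟨i, hi, hiN⟩ := ((hlim.eventually (hV.connectedComponentIn.mem_nhds hpW)).and
    (hr.tendsto_atTop.eventually_ge_atTop N)).exists
  exact ⟨r i, hiN, mapsTo_iterate_component_of_mem hf hfV hpW hi⟩

/-- Each chosen term exceeds twice the previous one, so each gap exceeds the previous gap. The gaps
serve as exponents of iterates tending to the identity. -/
theorem StrictMono.exists_comp_gap_strictMono {n : ℕ → ℕ} (hn : StrictMono n) :
    ∃ ψ : ℕ → ℕ, StrictMono ψ ∧ StrictMono fun i => n (ψ (i + 1)) - n (ψ i) := by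
  let ψ : ℕ → ℕ := fun i => Nat.rec 0 (fun _ a => 2 * n a + a + 1) i
  have hψ : ∀ i, ψ (i + 1) = 2 * n (ψ i) + ψ i + 1 := fun i => rfl
  have hge : ∀ i, 2 * n (ψ i) + 1 ≤ n (ψ (i + 1)) := fun i => by
    have := hn.id_le (ψ (i + 1))
    rw [hψ] at this ⊢
    simp only [id] at this
    omega
  refine ⟨ψ, strictMono_nat_of_lt_succ fun i => by rw [hψ]; omega,
    strictMono_nat_of_lt_succ fun i => ?_⟩
  have h1 := hge i
  have h2 := hge (i + 1)
  omega

/-- A limit of iterates that is open at a point, with value in `V` there, makes the component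
a Siegel domain. -/
theorem isSiegelDomain_of_open_limit (hV : IsOpen V) (hyp : IsKobayashiHyperbolic V)
    (hf : DifferentiableOn ℂ f V) (hfV : MapsTo f V V)
    (hfo : ∀ O ⊆ V, IsOpen O → IsOpen (f '' O)) {W : Set (Ck k)} (hW : IsOpen W)
    (hWc : IsPreconnected W) (hWV : W ⊆ V) (hret : ∀ N, ∃ M ≥ N, MapsTo f^[M] W W)
    {n : ℕ → ℕ} (hn : StrictMono n) {h : Ck k → Ck k}
    (hlim : ∀ z ∈ W, Tendsto (fun i => f^[n i] z) atTop (𝓝 (h z))) {x : Ck k} (hx : x ∈ W)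
    (hhx : h x ∈ V) (hopen : 𝓝 (h x) ≤ map h (𝓝 x)) : IsSiegelDomain f W := by
  obtain ⟨ψ, hψ, hgap⟩ := hn.exists_comp_gap_strictMono
  set m : ℕ → ℕ := fun i => n (ψ (i + 1)) - n (ψ i) with hm
  have hlimψ : ∀ z ∈ W, Tendsto (fun i => f^[n (ψ i)] z) atTop (𝓝 (h z)) := fun z hz =>
    (hlim z hz).comp hψ.tendsto_atTop
  -- `f^[m i]` takes `f^[n (ψ i)] z` to `f^[n (ψ (i + 1))] z`, and both are close to `h z`.
  have hid : ∀ z ∈ W, h z ∈ V → Tendsto (fun i => f^[m i] (h z)) atTop (𝓝 (h z)) := by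
    intro z hz hhz
    refine hyp.tendsto_of_tendsto_kobayashiDist hV hhz fun ε hε => ?_
    have hε2 := ENNReal.half_pos hε.ne'
    have h1 := (hlimψ z hz).eventually (eventually_kobayashiDist_lt hV hhz hε2)
    filter_upwards [h1, (tendsto_add_atTop_nat 1).eventually h1] with i hi hi'
    have hle : n (ψ i) ≤ n (ψ (i + 1)) := hn.monotone (hψ.monotone (Nat.le_succ i))
    have hsplit : f^[n (ψ (i + 1))] z = f^[m i] (f^[n (ψ i)] z) := by
      rw [← Function.iterate_add_apply, Nat.sub_add_cancel hle]
    calc kobayashiDist V (h z) (f^[m i] (h z))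
        ≤ kobayashiDist V (h z) (f^[n (ψ (i + 1))] z) +
          kobayashiDist V (f^[n (ψ (i + 1))] z) (f^[m i] (h z)) := kobayashiDist_triangle _ _ _
      _ ≤ kobayashiDist V (h z) (f^[n (ψ (i + 1))] z) +
          kobayashiDist V (h z) (f^[n (ψ i)] z) := by
          rw [hsplit, kobayashiDist_comm (h z) (f^[n (ψ i)] z)]
          gcongr
          exact kobayashiDist_iterate_le hf hfV _ _ _
      _ < ε / 2 + ε / 2 := ENNReal.add_lt_add hi' hi
      _ = ε := ENNReal.add_halves ε
  -- the iterates converge to the identity near `h x`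
  have hnear : ∀ᶠ y in 𝓝 (h x), y ∈ V ∧ Tendsto (fun i => f^[m i] y) atTop (𝓝 y) := by
    refine (hV.eventually_mem hhx).and ?_
    have hmem : h '' W ∈ 𝓝 (h x) := hopen (image_mem_map (hW.mem_nhds hx))
    filter_upwards [hmem, hV.eventually_mem hhx] with y hy hyV
    obtain ⟨z, hz, rfl⟩ := hy
    exact hid z hz hyV
  obtain ⟨O, hO, hOo, hxO⟩ := eventually_nhds_iff.1 hnear
  have hOV : O ⊆ V := fun y hy => (hO y hy).1
  obtain ⟨i, hi⟩ := ((hlim x hx).eventually (hOo.mem_nhds hxO)).exists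
  obtain ⟨M, hM, hMW⟩ := hret (n i)
  have hM' : f^[M - n i] (f^[n i] x) ∈ W := by
    rw [← Function.iterate_add_apply, Nat.sub_add_cancel hM]
    exact hMW hx
  refine ⟨m, hgap, tendstoLocallyUniformlyOn_iterate_id hV hyp hf hfV hW hWc hWV hM' ?_⟩
  -- Convergence to the identity passes from `O` to its image because iterates commute; openness of
  -- `f` makes that image a neighbourhood.
  filter_upwards [(isOpen_image_iterate hfo hfV (M - n i) O hOV hOo).mem_nhds
    (mem_image_of_mem _ hi)] with w hw
  obtain ⟨y, hy, rfl⟩ := hw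
  have hc : ContinuousAt f^[M - n i] y :=
    (hf.iterate_of_mapsTo hfV _).continuousOn.continuousAt (hV.mem_nhds (hOV hy))
  refine (hc.tendsto.comp (hO y hy).2).congr fun j => ?_
  simp only [Function.comp_apply, ← Function.iterate_add_apply, add_comm]

end Dynamics

/-! ### Constant limits and ranks of limit maps -/

section Classification

variable {k : ℕ} {V : Set (Ck k)} {f : Ck k → Ck k}

theorem spectralRadius_lt_one_of_norm_lt_one {A : Ck k →L[ℂ] Ck k} (hA : ‖A‖ < 1) :
    spectralRadius ℂ A < 1 := by
  have h := spectrum.spectralRadius_le_pow_nnnorm_pow_one_div ℂ A 0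
  simp only [zero_add, pow_one, Nat.cast_zero, div_one, ENNReal.rpow_one] at h
  have h1 : ‖(1 : Ck k →L[ℂ] Ck k)‖₊ ≤ 1 := ContinuousLinearMap.norm_id_le
  have h2 : ‖A‖₊ < 1 := hA
  refine h.trans_lt ?_
  rw [← ENNReal.coe_mul]
  exact_mod_cast (mul_le_of_le_one_right zero_le h1).trans_lt h2

/-- If iterates of a point converge to a periodic point, then the whole orbit converges to the
periodic orbit. -/
theorem tendsto_infDist_orbit (hV : IsOpen V) (hyp : IsKobayashiHyperbolic V)
    (hf : DifferentiableOn ℂ f V) (hfV : MapsTo f V V) {p z : Ck k} (hp : p ∈ V) {m : ℕ}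
    (hm : 0 < m) (hmp : f^[m] p = p) {N : ℕ → ℕ}
    (hlim : Tendsto (fun i => f^[N i] z) atTop (𝓝 p)) :
    Tendsto (fun n : ℕ => Metric.infDist (f^[n] z) (range fun j : ℕ => f^[j] p)) atTop (𝓝 0) := by
  rw [Metric.tendsto_nhds]
  intro r hr
  -- One `δ` serves the finitely many points of the periodic orbit.
  have hB : ∀ T : ℕ, ∃ δ : ℝ≥0∞, 0 < δ ∧ ∀ j < T, ∀ y, kobayashiDist V (f^[j] p) y < δ →
      dist y (f^[j] p) < r := by
    intro T
    induction T with
    | zero => exact ⟨1, one_pos, by simp⟩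
    | succ T ih =>
      obtain ⟨δ, hδ, h⟩ := ih
      obtain ⟨δ', hδ', h'⟩ := hyp.exists_dist_lt hV (hfV.iterate T hp) hr
      refine ⟨min δ δ', lt_min hδ hδ', fun j hj y hy => ?_⟩
      rcases Nat.lt_succ_iff_lt_or_eq.1 hj with hj | rfl
      · exact h j hj y (hy.trans_le (min_le_left _ _))
      · exact h' y (hy.trans_le (min_le_right _ _))
  obtain ⟨δ, hδ, hd⟩ := hB m
  obtain ⟨i, hi⟩ := (hlim.eventually (eventually_kobayashiDist_lt hV hp hδ)).exists
  filter_upwards [eventually_ge_atTop (N i)] with n hn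
  have hper : f^[n - N i] p = f^[(n - N i) % m] p := by
    conv_lhs => rw [← Nat.mod_add_div (n - N i) m, Function.iterate_add_apply,
      Function.iterate_mul, Function.iterate_fixed hmp]
  have hsplit : f^[n] z = f^[n - N i] (f^[N i] z) := by
    rw [← Function.iterate_add_apply, Nat.sub_add_cancel hn]
  have hclose : dist (f^[n] z) (f^[(n - N i) % m] p) < r := by
    refine hd _ (Nat.mod_lt _ hm) _ ?_
    rw [hsplit, ← hper]
    exact (kobayashiDist_iterate_le hf hfV _ _ _).trans_lt hi
  rw [Real.dist_0_eq_abs, abs_of_nonneg Metric.infDist_nonneg]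
  exact (Metric.infDist_le_dist_of_mem (mem_range_self _)).trans_lt hclose

/-- If a subsequence of the iterates converges to a constant on the component of a recurrent point,
then this component is an attracting basin. -/
theorem isAttractingBasin_of_const_limit (hV : IsOpen V) (hyp : IsKobayashiHyperbolic V)
    (hf : DifferentiableOn ℂ f V) (hfV : MapsTo f V V) {p₀ : Ck k} (hp₀ : p₀ ∈ V)
    (hrec : IsRecurrentPoint f p₀) {n : ℕ → ℕ} (hn : StrictMono n) {q : Ck k}
    (hlim : TendstoLocallyUniformlyOn (fun i => f^[n i]) (fun _ => q) atTop
      (connectedComponentIn V p₀)) :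
    IsAttractingBasin f V (connectedComponentIn V p₀) := by
  set W := connectedComponentIn V p₀ with hWdef
  have hWV : W ⊆ V := connectedComponentIn_subset V p₀
  have hWo : IsOpen W := hV.connectedComponentIn
  have hp₀W : p₀ ∈ W := mem_connectedComponentIn hp₀
  have hqV : q ∈ V := by
    obtain ⟨K, hKV, hK, horb⟩ := hrec.exists_isCompact hV hyp hf hfV hp₀
    exact hKV (hK.isClosed.mem_of_tendsto (hlim.tendsto_at hp₀W)
      (Eventually.of_forall fun i => horb _))
  have hdiff := hf.iterate_of_mapsTo hfV
  have hcont : ∀ j, ∀ y ∈ V, ContinuousAt f^[j] y := fun j y hy =>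
    (hdiff j).continuousOn.continuousAt (hV.mem_nhds hy)
  obtain ⟨i₀, hi₀⟩ := ((hlim.tendsto_at hp₀W).eventually
    (hV.connectedComponentIn.mem_nhds (mem_connectedComponentIn hqV))).exists
  obtain ⟨M, hM, hMW⟩ := hrec.exists_mapsTo_component hV hf hfV hp₀ (n i₀)
  set j := M - n i₀ with hj
  -- `f^[n i₀] p₀` lies in the component of `q`, and `j` more steps take it into `W`; hence `f^[j]`
  -- sends `q` there too.
  have hpW : f^[j] q ∈ W := by
    have h1 : f^[M] p₀ ∈ connectedComponentIn V (f^[j] q) := by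
      have := mapsTo_iterate_connectedComponentIn hf hfV hqV j hi₀
      rwa [← Function.iterate_add_apply, Nat.sub_add_cancel hM] at this
    have h2 : connectedComponentIn V (f^[j] q) = W :=
      (connectedComponentIn_eq h1).trans (connectedComponentIn_eq (hMW hp₀W)).symm
    exact h2 ▸ mem_connectedComponentIn (hfV.iterate j hqV)
  set p := f^[j] q with hp
  have hlimp : TendstoLocallyUniformlyOn (fun i => f^[j + n i]) (fun _ => p) atTop W := by
    rw [Metric.tendstoLocallyUniformlyOn_iff] at hlim ⊢
    intro ε hε x hx
    obtain ⟨δ, hδ, hδε⟩ := Metric.continuousAt_iff.1 (hcont j q hqV) ε hε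
    obtain ⟨t, ht, hev⟩ := hlim δ hδ x hx
    refine ⟨t, ht, hev.mono fun i hi y hy => ?_⟩
    rw [dist_comm, Function.iterate_add_apply]
    exact hδε (by rw [dist_comm]; exact hi y hy)
  have hderiv : Tendsto (fun i => fderiv ℂ f^[j + n i] p) atTop (𝓝 0) := by
    simpa using (differentiableAt_and_tendsto_fderiv_of_tendstoLocallyUniformlyOn hWo
      (fun i => (hdiff (j + n i)).mono hWV) hlimp hpW).2
  obtain ⟨i, hiW, hi1, hi0⟩ := ((hlimp.tendsto_at hpW).eventually (hWo.mem_nhds hpW)).and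
    (((tendsto_zero_iff_norm_tendsto_zero.1 hderiv).eventually_lt_const one_pos).and
      (hn.tendsto_atTop.eventually_gt_atTop 0)) |>.exists
  set m := j + n i with hm
  have hmW : MapsTo f^[m] W W := mapsTo_iterate_component_of_mem hf hfV hpW hiW
  -- The iterates `f^[j + n l]` at `f^[m] p` tend to `p` since that point is in `W`, and to `f^[m]
  -- p` by commutation.
  have hmp : f^[m] p = p := by
    refine tendsto_nhds_unique
      ((hcont m p (hWV hpW)).tendsto.comp (hlimp.tendsto_at hpW)) ?_
    refine (hlimp.tendsto_at (hmW hpW)).congr fun l => ?_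
    simp only [Function.comp_apply, ← Function.iterate_add_apply, add_comm]
  refine ⟨p, hpW, ⟨m, by omega, hmp, (hdiff m).differentiableAt (hV.mem_nhds (hWV hpW)),
    spectralRadius_lt_one_of_norm_lt_one hi1⟩, Subset.antisymm ?_ ?_⟩
  · refine isPreconnected_connectedComponentIn.subset_connectedComponentIn hpW fun z hz => ?_
    exact ⟨fun l => hfV.iterate l (hWV hz), tendsto_infDist_orbit hV hyp hf hfV (hWV hpW)
      (by omega : 0 < m) hmp (hlimp.tendsto_at hz)⟩
  · rw [hWdef, connectedComponentIn_eq hpW]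
    exact connectedComponentIn_mono p fun z hz => hz.1 0

/-- The bound `k` keeps `sSup` on `ℕ` from its default value `0`. -/
theorem finrank_range_fderiv_le_rankOn (h : Ck k → Ck k) {W : Set (Ck k)} {x : Ck k}
    (hx : x ∈ W) :
    Module.finrank ℂ (LinearMap.range (fderiv ℂ h x).toLinearMap) ≤ rankOn h W := by
  refine le_csSup ⟨k, ?_⟩ ⟨x, hx, rfl⟩
  rintro r ⟨y, -, rfl⟩
  simpa using (LinearMap.range (fderiv ℂ h y).toLinearMap).finrank_le

theorem exists_surjective_fderiv_of_le_rankOn (h : Ck k → Ck k) {W : Set (Ck k)}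
    (hW : W.Nonempty) (hr : k ≤ rankOn h W) :
    ∃ x ∈ W, LinearMap.range (fderiv ℂ h x).toLinearMap = ⊤ := by
  obtain ⟨x₀, hx₀⟩ := hW
  have hmem : rankOn h W ∈ {r : ℕ | ∃ x ∈ W,
      r = Module.finrank ℂ (LinearMap.range (fderiv ℂ h x).toLinearMap)} := by
    refine Nat.sSup_mem ⟨_, x₀, hx₀, rfl⟩ ⟨k, ?_⟩
    rintro r ⟨y, -, rfl⟩
    simpa using (LinearMap.range (fderiv ℂ h y).toLinearMap).finrank_le
  obtain ⟨x, hx, hxr⟩ := hmem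
  refine ⟨x, hx, Submodule.eq_top_of_finrank_eq (le_antisymm (Submodule.finrank_le _) ?_)⟩
  simpa [← hxr] using hr

theorem exists_eqOn_const_of_rankOn_eq_zero {h : Ck k → Ck k} {W : Set (Ck k)} (hW : IsOpen W)
    (hWc : IsPreconnected W) (hh : DifferentiableOn ℂ h W) (hr : rankOn h W = 0) :
    ∃ q, ∀ x ∈ W, h x = q := by
  refine hW.exists_is_const_of_fderiv_eq_zero hWc hh fun x hx => ?_
  have h0 : Module.finrank ℂ (LinearMap.range (fderiv ℂ h x).toLinearMap) = 0 :=
    Nat.le_zero.1 (hr ▸ finrank_range_fderiv_le_rankOn h hx)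
  rw [Submodule.finrank_eq_zero, LinearMap.range_eq_bot] at h0
  ext1 v
  exact LinearMap.congr_fun h0 v

end Classification

/-! ### Invariance of `V` and the trichotomy -/

theorem theorem3p4 (k : ℕ) (U : Set (Ck k)) (hUo : IsOpen U) (hUc : IsConnected U)
    (hU : Bornology.IsBounded U ∨ IsKobayashiHyperbolic U)
    (hbar : ∀ q ∈ frontier U, HasPSHBarrierAt U q)
    (f : Ck k → Ck k) (hf : DifferentiableOn ℂ f U)
    (hfo : ∀ O : Set (Ck k), O ⊆ U → IsOpen O → IsOpen (f '' O))
    (C : Set (Ck k)) (hCU : C ⊆ U) (hC : MapsTo f C C) :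
    (∀ n : ℕ, MapsTo f^[n] (interiorOfClosureIn U C) U) ∧
    IteratesKobayashiEquicontinuousOn f U (interiorOfClosureIn U C) ∧
    (Bornology.IsBounded U → IteratesNormalOn f (interiorOfClosureIn U C)) ∧
    ∀ p₀ ∈ interiorOfClosureIn U C, IsRecurrentPoint f p₀ →
      ∀ W : Set (Ck k), W = connectedComponentIn (interiorOfClosureIn U C) p₀ →
        IsAttractingBasin f (interiorOfClosureIn U C) W ∨
        IsSiegelDomain f W ∨
        ∀ (n : ℕ → ℕ) (h : Ck k → Ck k), StrictMono n →
          TendstoLocallyUniformlyOn (fun i => f^[n i]) h atTop W →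
          0 < rankOn h W ∧ rankOn h W < k := by
  have hint : interior (closure C) ⊆ U := fun q hq =>
    interior_closure_subset_of_barrier hbar (interior_mono (closure_mono hCU) hq)
  set V := interiorOfClosureIn U C with hVdef
  have hV : IsOpen V := isOpen_interior
  have hVU : V ⊆ U := fun x hx => (interior_subset hx).2
  have hVC : V ⊆ closure C := fun x hx => (interior_subset hx).1
  have hmemV : ∀ y, y ∈ interior (closure C) → y ∈ V := fun y hy =>
    mem_interior.2 ⟨interior (closure C), fun z hz => ⟨interior_subset hz, hint hz⟩,
      isOpen_interior, hy⟩
  have hfV : MapsTo f V V := by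
    have himg : f '' V ⊆ closure C := by
      rintro _ ⟨x, hx, rfl⟩
      exact (hf.continuousOn.continuousAt (hUo.mem_nhds (hVU hx))).continuousWithinAt.mem_closure
        (hVC hx) hC
    exact fun x hx => hmemV _ (interior_maximal himg (hfo V hVU hV) (mem_image_of_mem f hx))
  have hyp : IsKobayashiHyperbolic V :=
    (hU.elim isKobayashiHyperbolic_of_isBounded id).mono hVU
  have hfd : DifferentiableOn ℂ f V := hf.mono hVU
  have hdiff := hfd.iterate_of_mapsTo hfV
  refine ⟨fun n x hx => hVU (hfV.iterate n hx), ?_, ?_, ?_⟩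
  · intro x hx ε hε
    filter_upwards [eventually_kobayashiDist_lt hV hx hε] with y hy n
    exact ((kobayashiDist_mono hVU _ _).trans (kobayashiDist_iterate_le hfd hfV n x y)).trans_lt hy
  · intro hb n
    obtain ⟨M, hM⟩ := hb.exists_norm_le
    refine exists_subseq_tendstoLocallyUniformlyOn hV (G := fun i => f^[n i])
      (fun i => hdiff _) fun x hx => ?_
    obtain ⟨R, hR, hsub⟩ := Metric.mem_nhds_iff.1 (hV.mem_nhds hx)
    exact ⟨R, hR, hsub, M, fun i y hy => hM _ (hVU (hfV.iterate _ (hsub hy)))⟩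
  · intro p₀ hp₀ hrec W hW
    have hWV : W ⊆ V := hW ▸ connectedComponentIn_subset V p₀
    have hWo : IsOpen W := hW ▸ hV.connectedComponentIn
    have hWc : IsPreconnected W := hW ▸ isPreconnected_connectedComponentIn
    have hp₀W : p₀ ∈ W := hW ▸ mem_connectedComponentIn hp₀
    by_contra! hcon
    obtain ⟨hA, hS, n, h, hn, hlim, hrank⟩ := hcon
    have hh : DifferentiableOn ℂ h W := fun x hx =>
      (differentiableAt_and_tendsto_fderiv_of_tendstoLocallyUniformlyOn hWo
        (fun i => (hdiff (n i)).mono hWV) hlim hx).1.differentiableWithinAt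
    rcases Nat.eq_zero_or_pos (rankOn h W) with h0 | hpos
    · obtain ⟨q, hq⟩ := exists_eqOn_const_of_rankOn_eq_zero hWo hWc hh h0
      subst hW
      exact hA (isAttractingBasin_of_const_limit hV hyp hfd hfV hp₀ hrec hn
        (hlim.congr_right fun x hx => hq x hx))
    · obtain ⟨x, hx, hsurj⟩ := exists_surjective_fderiv_of_le_rankOn h ⟨p₀, hp₀W⟩ (hrank hpos)
      have hmap : map h (𝓝 x) = 𝓝 (h x) :=
        (hasStrictFDerivAt_of_differentiableOn hWo hh hx).map_nhds_eq_of_surj hsurj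
      -- Values of `h` could a priori leave `V`; but `h '' W` is in the closure of `C` and is a
      -- neighbourhood of `h x`.
      have hhC : h '' W ⊆ closure C := by
        rintro _ ⟨z, hz, rfl⟩
        exact isClosed_closure.mem_of_tendsto (hlim.tendsto_at hz)
          (Eventually.of_forall fun i => hVC (hfV.iterate _ (hWV hz)))
      have hhx : h x ∈ V := hmemV _ (mem_interior_iff_mem_nhds.2
        (mem_of_superset (hmap ▸ image_mem_map (hWo.mem_nhds hx)) hhC))
      exact hS (isSiegelDomain_of_open_limit hV hyp hfd hfV
        (fun O hO => hfo O (hO.trans hVU)) hWo hWc hWV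
        (fun N => hW ▸ hrec.exists_mapsTo_component hV hfd hfV hp₀ N) hn
        (fun z hz => hlim.tendsto_at hz) hx hhx hmap.ge)
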